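/- Let $d \ge 0$, let $(\Omega,\mathcal F,\mathbb P)$ be a probability space, and let $B=(B_t)_{0\le t\le 1}$ be a Brownian motion on $\mathbb R^d$ with an arbitrary initial law $B_0\sim\alpha$. Let $v\colon\mathbb R^d\to\mathbb R$ be convex such that $\nabla v(B_1)$ is square-integrable, and let $M=(M_t)_{0\le t\le 1}$ be the associated Bass martingale, i.e. for every $t\in[0,1]$ $$M_t=\mathbb E\big[\nabla v(B_1)\,\big|\,\sigma(B_s\colon s\le t)\big]\quad\text{a.s.},$$ taken in a version with almost surely right-continuous paths. Let $\nu$ be the law of $M_1$ and let $C$ denote the closed convex hull of the support of $\nu$, with relative interior $\operatorname{ri} C$. Then, almost surely, $M_t\in\operatorname{ri} C$ for all $t\in[0,1)$. Equivalently, the time $$\tau:=\inf\{t\in[0,1]\colon M_t\notin\operatorname{ri} C\}\wedge 1\qquad(\inf\varnothing:=+\infty)$$ satisfies $\tau=1$ almost surely. -/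

import Mathlib

open MeasureTheory ProbabilityTheory Set
open scoped unitInterval Gradient

/-- The centered Gaussian law on `ℝᵈ` with covariance matrix `r • 1`, for `r ≥ 0`: the law of
`√r • Z` with `Z` standard Gaussian. For `r = 0` it is the Dirac mass at `0`. -/
noncomputable def isotropicGaussian (d : ℕ) (r : ℝ) : Measure (EuclideanSpace ℝ (Fin d)) :=
  (stdGaussian (EuclideanSpace ℝ (Fin d))).map (fun z => √r • z)

/-- `B = (B_t)_{0 ≤ t ≤ 1}` is a Brownian motion on `ℝᵈ` with initial law `B_0 ∼ α`:
the increment `B_t - B_s` is independent of `(B_r)_{r ≤ s}` and has the centered Gaussian law with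
covariance matrix `(t - s) • 1`, and almost all paths are continuous. -/
structure IsBrownianMotionOn01 {d : ℕ} {Ω : Type*} [MeasurableSpace Ω]
    (B : I → Ω → EuclideanSpace ℝ (Fin d)) (α : Measure (EuclideanSpace ℝ (Fin d)))
    (P : Measure Ω) : Prop where
  measurable : ∀ t, Measurable (B t)
  hasLaw_zero : HasLaw (B 0) α P
  hasLaw_increment : ∀ s t : I, s ≤ t →
    HasLaw (fun ω => B t ω - B s ω) (isotropicGaussian d ((t : ℝ) - (s : ℝ))) P
  indepFun_past : ∀ s t : I, s ≤ t →
    IndepFun (fun ω => B t ω - B s ω) (fun ω (r : Iic s) => B r ω) P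
  continuous_paths : ∀ᵐ ω ∂P, Continuous (fun t => B t ω)

/-- The σ-algebra `σ(B_s : s ≤ t)`. -/
abbrev pastSigmaAlgebra {d : ℕ} {Ω : Type*} (B : I → Ω → EuclideanSpace ℝ (Fin d)) (t : I) :
    MeasurableSpace Ω :=
  ⨆ s : I, ⨆ _ : s ≤ t, MeasurableSpace.comap (B s) inferInstance

/-- `M = (M_t)_{0 ≤ t ≤ 1}` is a Bass martingale: there are a Brownian motion `B` on `ℝᵈ` with some
initial law `α` and a convex `v : ℝᵈ → ℝ` such that `∇v(B_1)` is square-integrable and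
`M_t = 𝔼[∇v(B_1) | σ(B_s : s ≤ t)]` almost surely, for every `t`.
Since this determines each `M_t` up to a null set only, a regular version is meant, as usual for
martingales: almost all paths are right-continuous. (A convex function is differentiable outside a
Lebesgue null set, which `B_1` almost surely avoids, so that the value of `∇ v` at the other points
plays no role.) -/
def IsBassMartingale {d : ℕ} {Ω : Type*} [MeasurableSpace Ω]
    (M : I → Ω → EuclideanSpace ℝ (Fin d)) (P : Measure Ω) : Prop :=
  ∃ (α : Measure (EuclideanSpace ℝ (Fin d))) (B : I → Ω → EuclideanSpace ℝ (Fin d))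
    (v : EuclideanSpace ℝ (Fin d) → ℝ),
    IsBrownianMotionOn01 B α P ∧
    ConvexOn ℝ univ v ∧
    MemLp (fun ω => ∇ v (B 1 ω)) 2 P ∧
    (∀ t : I, M t =ᵐ[P] P[fun ω => ∇ v (B 1 ω) | pastSigmaAlgebra B t]) ∧
    ∀ᵐ ω ∂P, ∀ t : I, ContinuousWithinAt (fun s => M s ω) (Ici t) t

/-- The relative interior of the closed convex hull of the support of `ν`. -/
def riSuppHull {d : ℕ} (ν : Measure (EuclideanSpace ℝ (Fin d))) :
    Set (EuclideanSpace ℝ (Fin d)) :=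
  intrinsicInterior ℝ (closedConvexHull ℝ ν.support)

/-- The time `τ = inf {t ∈ [0,1] : M_t ∉ ri C} ∧ 1`, where `C` is the closed convex hull of the
support of `ν`; it is `1` when there is no such `t`. -/
noncomputable def boundaryTime {d : ℕ} {Ω : Type*}
    (M : I → Ω → EuclideanSpace ℝ (Fin d)) (ν : Measure (EuclideanSpace ℝ (Fin d))) : Ω → I :=
  hittingBtwn M (riSuppHull ν)ᶜ 0 1

/-! Write g = ∇v and K_r(x) = ∫ g(x + z) dγ_r(z), where γ_r is the centered Gaussian of variance r.
By the Markov property, M_t = K_{1-t}(B_t) a.s. for each fixed t (`condExp_comp_eq`).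

For r > 0 every translate of γ_r has exactly the Lebesgue null sets, and so does the law of B_1,
whatever α is. Hence the law of g(x + Z), Z ∼ γ_r, has the null sets of ν. Its mean K_r(x) lies in
C; were it outside ri C, a hyperplane supporting C there and not containing C would carry this law,
hence ν, hence C, a contradiction (`integral_isotropicGaussian_mem_riSuppHull`).

This holds at every x where the integral converges, so null sets only enter through M = K. As K is
jointly continuous for 0 < r < 1, equality on a countable dense set of times extends to all t in
(0,1) by right-continuity of M (`ae_forall_mem_riSuppHull`). -/

/-! ### Gaussian densities and null sets -/

/-- The Lebesgue density of `isotropicGaussian d r`, for `r > 0`. -/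
noncomputable def isotropicGaussianPDF (d : ℕ) (r : ℝ) (z : EuclideanSpace ℝ (Fin d)) : ℝ :=
  ((2 * Real.pi * r) ^ ((d : ℝ) / 2))⁻¹ * Real.exp (-(2 * r)⁻¹ * ‖z‖ ^ 2)

theorem isotropicGaussianPDF_pos (d : ℕ) {r : ℝ} (hr : 0 < r) (z : EuclideanSpace ℝ (Fin d)) :
    0 < isotropicGaussianPDF d r z := by
  unfold isotropicGaussianPDF; positivity

theorem measurable_isotropicGaussianPDF (d : ℕ) (r : ℝ) :
    Measurable (isotropicGaussianPDF d r) := by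
  unfold isotropicGaussianPDF; fun_prop

theorem integrable_isotropicGaussianPDF (d : ℕ) {r : ℝ} (hr : 0 < r) :
    Integrable (isotropicGaussianPDF d r) := by
  have hb : 0 < (2 * r)⁻¹ := by positivity
  refine Integrable.const_mul (.of_integral_ne_zero ?_) _
  rw [GaussianFourier.integral_rexp_neg_mul_sq_norm hb]
  positivity

instance isProbabilityMeasure_isotropicGaussian (d : ℕ) (r : ℝ) :
    IsProbabilityMeasure (isotropicGaussian d r) :=
  Measure.isProbabilityMeasure_map (by fun_prop)

/-- Both sides are finite measures with characteristic function exp(-r‖t‖²/2). -/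
theorem isotropicGaussian_eq_withDensity (d : ℕ) {r : ℝ} (hr : 0 < r) :
    isotropicGaussian d r =
      volume.withDensity fun z => ENNReal.ofReal (isotropicGaussianPDF d r z) := by
  have : IsFiniteMeasure (volume.withDensity fun z : EuclideanSpace ℝ (Fin d) =>
      ENNReal.ofReal (isotropicGaussianPDF d r z)) :=
    isFiniteMeasure_withDensity_ofReal (integrable_isotropicGaussianPDF d hr).2
  have hb : 0 < (2 * r)⁻¹ := by positivity
  refine Measure.ext_of_charFun (funext fun t => ?_)
  have h1 : charFun (isotropicGaussian d r) t = Complex.exp (-(r * ‖t‖ ^ 2) / 2) := by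
    rw [isotropicGaussian, charFun_map_smul, charFun_stdGaussian, norm_smul, Real.norm_eq_abs,
      abs_of_nonneg (Real.sqrt_nonneg r), Complex.ofReal_mul, mul_pow, ← Complex.ofReal_pow (√r),
      Real.sq_sqrt hr.le]
  rw [h1, charFun_apply, integral_withDensity_eq_integral_toReal_smul
    (measurable_isotropicGaussianPDF d r).ennreal_ofReal (by simp)]
  have h2 (z : EuclideanSpace ℝ (Fin d)) :
      (ENNReal.ofReal (isotropicGaussianPDF d r z)).toReal •
        Complex.exp (inner ℝ z t * Complex.I) =
      (((2 * Real.pi * r) ^ ((d : ℝ) / 2))⁻¹ : ℝ) *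
        Complex.exp (-((2 * r)⁻¹ : ℝ) * ‖z‖ ^ 2 + Complex.I * inner ℝ t z) := by
    rw [ENNReal.toReal_ofReal (isotropicGaussianPDF_pos d hr z).le, Complex.real_smul,
      isotropicGaussianPDF, Complex.ofReal_mul, Complex.exp_add, real_inner_comm t z, mul_assoc]
    push_cast
    ring_nf
  simp_rw [h2]
  rw [integral_const_mul, GaussianFourier.integral_cexp_neg_mul_sq_norm_add
    (show 0 < (((2 * r)⁻¹ : ℝ) : ℂ).re from hb) Complex.I t, ← mul_assoc]
  have h3 : (((2 * Real.pi * r) ^ ((d : ℝ) / 2))⁻¹ : ℝ) *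
      ((Real.pi : ℂ) / ((2 * r)⁻¹ : ℝ)) ^
        ((Module.finrank ℝ (EuclideanSpace ℝ (Fin d)) : ℂ) / 2) = 1 := by
    have h4 : (Real.pi : ℂ) / ((2 * r)⁻¹ : ℝ) = ((2 * Real.pi * r : ℝ) : ℂ) := by
      push_cast; field_simp
    have h5 : ((d : ℂ) / 2) = (((d : ℝ) / 2 : ℝ) : ℂ) := by push_cast; rfl
    rw [h4, finrank_euclideanSpace_fin, h5, ← Complex.ofReal_cpow (by positivity),
      ← Complex.ofReal_mul, inv_mul_cancel₀ (by positivity), Complex.ofReal_one]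
  rw [h3, one_mul]
  congr 1
  have : (r : ℂ) ≠ 0 := by exact_mod_cast hr.ne'
  push_cast
  rw [Complex.I_sq]
  field_simp
  norm_num

theorem isotropicGaussian_absolutelyContinuous (d : ℕ) {r : ℝ} (hr : 0 < r) :
    isotropicGaussian d r ≪ volume := by
  rw [isotropicGaussian_eq_withDensity d hr]
  exact withDensity_absolutelyContinuous _ _

theorem absolutelyContinuous_isotropicGaussian (d : ℕ) {r : ℝ} (hr : 0 < r) :
    volume ≪ isotropicGaussian d r := by
  rw [isotropicGaussian_eq_withDensity d hr]
  exact withDensity_absolutelyContinuous'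
    (measurable_isotropicGaussianPDF d r).ennreal_ofReal.aemeasurable
    (.of_forall fun z => (ENNReal.ofReal_pos.2 (isotropicGaussianPDF_pos d hr z)).ne')

/-- The Gaussian is equivalent to Lebesgue measure, which is translation invariant; thus the null
sets depend on neither x nor r. -/
theorem ae_isotropicGaussian_add_iff {d : ℕ} {r : ℝ} (hr : 0 < r) (x : EuclideanSpace ℝ (Fin d))
    {p : EuclideanSpace ℝ (Fin d) → Prop} :
    (∀ᵐ z ∂isotropicGaussian d r, p (x + z)) ↔ ∀ᵐ y, p y := by
  have h := (measurePreserving_add_left volume x)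
  constructor
  · intro hp
    have hp' := (absolutelyContinuous_isotropicGaussian d hr).ae_le hp
    have := (measurePreserving_add_left volume (-x)).quasiMeasurePreserving.ae hp'
    simpa using this
  · intro hp
    exact (isotropicGaussian_absolutelyContinuous d hr).ae_le (h.quasiMeasurePreserving.ae hp)

/-! ### Gaussian averages: integrability and joint continuity -/

section Kernel

variable {d : ℕ} {F : Type*} [NormedAddCommGroup F] [NormedSpace ℝ F]

theorem integrable_isotropicGaussian_add_iff {r : ℝ} (hr : 0 < r)
    (x : EuclideanSpace ℝ (Fin d)) (g : EuclideanSpace ℝ (Fin d) → F) :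
    Integrable (fun z => g (x + z)) (isotropicGaussian d r) ↔
      Integrable fun y => isotropicGaussianPDF d r (y - x) • g y := by
  rw [isotropicGaussian_eq_withDensity d hr, integrable_withDensity_iff_integrable_smul'
    (measurable_isotropicGaussianPDF d r).ennreal_ofReal (by simp)]
  simp_rw [ENNReal.toReal_ofReal (isotropicGaussianPDF_pos d hr _).le]
  rw [← (measurePreserving_add_left volume x).integrable_comp_emb
    (measurableEmbedding_addLeft x) (g := fun y => isotropicGaussianPDF d r (y - x) • g y)]
  simp [Function.comp_def]

theorem integral_isotropicGaussian_add {r : ℝ} (hr : 0 < r)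
    (x : EuclideanSpace ℝ (Fin d)) (g : EuclideanSpace ℝ (Fin d) → F) :
    ∫ z, g (x + z) ∂isotropicGaussian d r =
      ∫ y, isotropicGaussianPDF d r (y - x) • g y := by
  rw [isotropicGaussian_eq_withDensity d hr, integral_withDensity_eq_integral_toReal_smul
    (measurable_isotropicGaussianPDF d r).ennreal_ofReal (by simp)]
  simp_rw [ENNReal.toReal_ofReal (isotropicGaussianPDF_pos d hr _).le]
  rw [← (measurePreserving_add_left volume x).integral_comp
    (measurableEmbedding_addLeft x) (fun y => isotropicGaussianPDF d r (y - x) • g y)]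
  simp

/-- Triangle inequality, then Cauchy–Schwarz with weights s and 1 - s: (a + R)² ≤ a²/s + R²/(1 - s).
-/
theorem norm_sub_sq_div_lower_bound {E : Type*} [SeminormedAddCommGroup E] {x₀ x y : E}
    {R s r : ℝ} (hr : 0 < r) (hrs : r ≤ s) (hs : s < 1) (hx : ‖x - x₀‖ ≤ R) :
    ‖y - x₀‖ ^ 2 - R ^ 2 / (1 - s) ≤ ‖y - x‖ ^ 2 / r := by
  have hs0 : 0 < s := hr.trans_le hrs
  have hs1 : 0 < 1 - s := by linarith
  have h1 : ‖y - x₀‖ ≤ ‖y - x‖ + R := by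
    calc ‖y - x₀‖ = ‖(y - x) + (x - x₀)‖ := by rw [sub_add_sub_cancel]
      _ ≤ _ := (norm_add_le _ _).trans (by gcongr)
  have h2 : ‖y - x₀‖ ^ 2 ≤ (‖y - x‖ + R) ^ 2 := by gcongr
  have h3 : (‖y - x‖ + R) ^ 2 ≤ ‖y - x‖ ^ 2 / s + R ^ 2 / (1 - s) := by
    have : ‖y - x‖ ^ 2 / s + R ^ 2 / (1 - s) - (‖y - x‖ + R) ^ 2 =
        ((1 - s) * ‖y - x‖ - s * R) ^ 2 / (s * (1 - s)) := by
      field_simp; ring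
    have : 0 ≤ ((1 - s) * ‖y - x‖ - s * R) ^ 2 / (s * (1 - s)) := by positivity
    linarith
  have h4 : ‖y - x‖ ^ 2 / s ≤ ‖y - x‖ ^ 2 / r := by gcongr
  linarith

/-- A variance bounded away from 1 absorbs a bounded shift of the center. The constant is uniform
over r in [q, s] and over the ball of radius R, as domination requires. -/
theorem isotropicGaussianPDF_sub_le {x₀ x y : EuclideanSpace ℝ (Fin d)} {R q s r : ℝ}
    (hq : 0 < q) (hqr : q ≤ r) (hrs : r ≤ s) (hs : s < 1) (hx : ‖x - x₀‖ ≤ R) :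
    isotropicGaussianPDF d r (y - x) ≤
      ((q ^ ((d : ℝ) / 2))⁻¹ * Real.exp (R ^ 2 / (1 - s) / 2)) *
        isotropicGaussianPDF d 1 (y - x₀) := by
  have hr : 0 < r := hq.trans_le hqr
  have h := norm_sub_sq_div_lower_bound (y := y) hr hrs hs hx
  have h1 : Real.exp (-(2 * r)⁻¹ * ‖y - x‖ ^ 2) ≤
      Real.exp (R ^ 2 / (1 - s) / 2) * Real.exp (-(2 * 1)⁻¹ * ‖y - x₀‖ ^ 2) := by
    rw [← Real.exp_add, Real.exp_le_exp]
    have : -(2 * r)⁻¹ * ‖y - x‖ ^ 2 = -(‖y - x‖ ^ 2 / r) / 2 := by field_simp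
    linarith
  have h2 : ((2 * Real.pi * r) ^ ((d : ℝ) / 2))⁻¹ ≤
      (q ^ ((d : ℝ) / 2))⁻¹ * ((2 * Real.pi * 1) ^ ((d : ℝ) / 2))⁻¹ := by
    rw [← mul_inv, mul_one, ← Real.mul_rpow hq.le (by positivity)]
    have : q * (2 * Real.pi) ≤ 2 * Real.pi * r := by nlinarith [Real.pi_pos]
    gcongr
  calc isotropicGaussianPDF d r (y - x) ≤ _ := mul_le_mul h2 h1 (by positivity) (by positivity)
    _ = _ := by rw [isotropicGaussianPDF]; ring

/-- Convergence at a single point for variance 1 spreads to every point for every smaller variance,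
by the density comparison. -/
theorem integrable_isotropicGaussian_add_of_integrable {x₀ : EuclideanSpace ℝ (Fin d)}
    {g : EuclideanSpace ℝ (Fin d) → F} (hgm : AEStronglyMeasurable g)
    (hg : Integrable (fun z => g (x₀ + z)) (isotropicGaussian d 1))
    {r : ℝ} (hr : 0 < r) (hr1 : r < 1) (x : EuclideanSpace ℝ (Fin d)) :
    Integrable (fun z => g (x + z)) (isotropicGaussian d r) := by
  rw [integrable_isotropicGaussian_add_iff one_pos] at hg
  rw [integrable_isotropicGaussian_add_iff hr]
  refine (hg.norm.const_mul ((r ^ ((d : ℝ) / 2))⁻¹ *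
    Real.exp (‖x - x₀‖ ^ 2 / (1 - r) / 2))).mono' ?_ (.of_forall fun y => ?_)
  · have := (measurable_isotropicGaussianPDF d r).comp (measurable_id.sub_const x)
    exact this.aestronglyMeasurable.smul hgm
  · rw [norm_smul, norm_smul, Real.norm_of_nonneg (isotropicGaussianPDF_pos d hr _).le,
      Real.norm_of_nonneg (isotropicGaussianPDF_pos d one_pos _).le, ← mul_assoc]
    gcongr
    exact isotropicGaussianPDF_sub_le hr le_rfl le_rfl hr1 le_rfl

/-- With the integral written against Lebesgue measure, only the smooth density depends on (r, x),
so dominated convergence applies even though g is merely measurable. -/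
theorem continuousAt_integral_isotropicGaussian_add {x₀ : EuclideanSpace ℝ (Fin d)}
    {g : EuclideanSpace ℝ (Fin d) → F} (hgm : AEStronglyMeasurable g)
    (hg : Integrable (fun z => g (x₀ + z)) (isotropicGaussian d 1))
    {r : ℝ} (hr : 0 < r) (hr1 : r < 1) (x : EuclideanSpace ℝ (Fin d)) :
    ContinuousAt (fun p : ℝ × EuclideanSpace ℝ (Fin d) =>
      ∫ z, g (p.2 + z) ∂isotropicGaussian d p.1) (r, x) := by
  rw [integrable_isotropicGaussian_add_iff one_pos] at hg
  obtain ⟨q, hq, hqr⟩ := exists_between hr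
  obtain ⟨s, hrs, hs⟩ := exists_between hr1
  have hev : ∀ᶠ p : ℝ × EuclideanSpace ℝ (Fin d) in nhds (r, x),
      (q < p.1 ∧ p.1 < s) ∧ ‖p.2 - x₀‖ < ‖x - x₀‖ + 1 := by
    refine ((continuousAt_fst.eventually (lt_mem_nhds hqr)).and
      (continuousAt_fst.eventually (gt_mem_nhds hrs))).and ?_
    have : ContinuousAt (fun p : ℝ × EuclideanSpace ℝ (Fin d) => ‖p.2 - x₀‖) (r, x) := by fun_prop
    exact this.eventually (gt_mem_nhds (lt_add_one _))
  have hcongr : (fun p : ℝ × EuclideanSpace ℝ (Fin d) =>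
      ∫ z, g (p.2 + z) ∂isotropicGaussian d p.1) =ᶠ[nhds (r, x)]
      fun p => ∫ y, isotropicGaussianPDF d p.1 (y - p.2) • g y := by
    filter_upwards [hev] with p hp
    exact integral_isotropicGaussian_add (hq.trans hp.1.1) p.2 g
  refine ContinuousAt.congr ?_ hcongr.symm
  refine continuousAt_of_dominated (bound := fun y => ((q ^ ((d : ℝ) / 2))⁻¹ *
    Real.exp ((‖x - x₀‖ + 1) ^ 2 / (1 - s) / 2)) * ‖isotropicGaussianPDF d 1 (y - x₀) • g y‖)
    (.of_forall fun p => ?_) ?_ (hg.norm.const_mul _) (.of_forall fun y => ?_)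
  · have := (measurable_isotropicGaussianPDF d p.1).comp (measurable_id.sub_const p.2)
    exact this.aestronglyMeasurable.smul hgm
  · filter_upwards [hev] with p hp
    refine .of_forall fun y => ?_
    have hp0 := hq.trans hp.1.1
    rw [norm_smul, norm_smul, Real.norm_of_nonneg (isotropicGaussianPDF_pos d hp0 _).le,
      Real.norm_of_nonneg (isotropicGaussianPDF_pos d one_pos _).le, ← mul_assoc]
    gcongr
    exact isotropicGaussianPDF_sub_le hq hp.1.1.le hp.1.2.le hs hp.2.le
  · refine ContinuousAt.smul ?_ continuousAt_const
    unfold isotropicGaussianPDF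
    have h1 : ContinuousAt (fun p : ℝ × EuclideanSpace ℝ (Fin d) =>
        (2 * Real.pi * p.1) ^ ((d : ℝ) / 2)) (r, x) :=
      ContinuousAt.rpow_const (by fun_prop) (.inl (by positivity))
    have h2 : ContinuousAt (fun p : ℝ × EuclideanSpace ℝ (Fin d) => (2 * p.1)⁻¹) (r, x) :=
      ContinuousAt.inv₀ (by fun_prop) (by positivity)
    exact (h1.inv₀ (by positivity)).mul
      (Real.continuous_exp.continuousAt.comp (h2.neg.mul (by fun_prop)))

end Kernel

/-! ### Means and the relative interior of a convex set -/

section RelativeInterior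

variable {E : Type*} [NormedAddCommGroup E] [InnerProductSpace ℝ E] [FiniteDimensional ℝ E]

/-- A point of a convex set outside its relative interior lies on a supporting hyperplane that does
not contain the set. -/
theorem Convex.exists_inner_le_of_notMem_intrinsicInterior {C : Set E} (hC : Convex ℝ C) {m : E}
    (hm : m ∈ C) (hmi : m ∉ intrinsicInterior ℝ C) :
    ∃ u : E, (∀ x ∈ C, inner ℝ u x ≤ inner ℝ u m) ∧ ∃ x ∈ C, inner ℝ u x < inner ℝ u m := by
  have hmA : m ∈ affineSpan ℝ C := subset_affineSpan ℝ C hm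
  -- Moving m to the origin of the direction space turns the relative interior of C into the
  -- ordinary interior of K.
  let V := (affineSpan ℝ C).direction
  have : Nonempty (affineSpan ℝ C) := ⟨⟨m, hmA⟩⟩
  let e : V ≃ᵢ affineSpan ℝ C := IsometryEquiv.vaddConst (⟨m, hmA⟩ : affineSpan ℝ C)
  let S : Set (affineSpan ℝ C) := (↑) ⁻¹' C
  let K : Set V := e ⁻¹' S
  have he (v : V) : ((e v : affineSpan ℝ C) : E) = (v : E) + m := rfl
  have hK : Convex ℝ K := by
    intro v hv w hw a b ha hb hab
    change ((e _ : affineSpan ℝ C) : E) ∈ C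
    have := hC hv hw ha hb hab
    rw [he] at this ⊢
    convert this using 1
    rw [he]
    push_cast
    have : m = (a + b) • m := by rw [hab, one_smul]
    nth_rewrite 1 [this]
    module
  have hint : interior K = e ⁻¹' interior S := (e.toHomeomorph.preimage_interior S).symm
  have hne : (interior K).Nonempty := by
    obtain ⟨_, p, hp, rfl⟩ := (Set.Nonempty.intrinsicInterior hC ⟨m, hm⟩)
    exact ⟨e.symm p, by rw [hint]; simpa using hp⟩
  have h0 : (0 : V) ∉ interior K := by
    intro h
    rw [hint] at h
    exact hmi ⟨e 0, h, by rw [he]; simp⟩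
  obtain ⟨f, hf⟩ := geometric_hahn_banach_open_point hK.interior isOpen_interior h0
  rw [map_zero] at hf
  have hle : ∀ v ∈ K, f v ≤ 0 := by
    -- Separation gives f < 0 on the interior only; K lies in the closure of its interior, so f ≤ 0
    -- on K.
    have hcl : closure (interior K) ⊆ {v | f v ≤ 0} :=
      closure_minimal (fun v hv => (hf v hv).le) (isClosed_le f.continuous continuous_const)
    intro v hv
    refine hcl ?_
    rw [hK.closure_interior_eq_closure_of_nonempty_interior hne]
    exact subset_closure hv
  let u : V := (InnerProductSpace.toDual ℝ V).symm f
  have hu (v : V) : inner ℝ (u : E) (v : E) = f v := by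
    rw [← Submodule.coe_inner, InnerProductSpace.toDual_symm_apply]
  refine ⟨u, fun x hx => ?_, ?_⟩
  · have hxA : x ∈ affineSpan ℝ C := subset_affineSpan ℝ C hx
    let v : V := ⟨x - m, AffineSubspace.vsub_mem_direction hxA hmA⟩
    have hv : v ∈ K := by
      change ((e v : affineSpan ℝ C) : E) ∈ C
      rw [he]; simpa [v] using hx
    have := hle v hv
    rw [← hu, inner_sub_right] at this
    linarith
  · obtain ⟨v, hv⟩ := hne
    refine ⟨(v : E) + m, ?_, ?_⟩
    · have := interior_subset hv
      exact this
    · rw [inner_add_right, hu]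
      linarith [hf v hv]

/-- If the mean were on the relative boundary, the nonnegative slack in the supporting inequality
would have integral zero, so X would lie a.s. in the supporting hyperplane; `h` then puts all of C
in it, although the hyperplane was chosen not to contain C. -/
theorem integral_mem_intrinsicInterior {Ω : Type*} [MeasurableSpace Ω] {μ : Measure Ω}
    [IsProbabilityMeasure μ] {X : Ω → E} (hX : Integrable X μ) {C : Set E} (hC : Convex ℝ C)
    (hCc : IsClosed C) (hXC : ∀ᵐ ω ∂μ, X ω ∈ C)
    (h : ∀ (u : E) (c : ℝ), (∀ᵐ ω ∂μ, inner ℝ u (X ω) = c) → ∀ x ∈ C, inner ℝ u x = c) :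
    ∫ ω, X ω ∂μ ∈ intrinsicInterior ℝ C := by
  by_contra hmi
  obtain ⟨u, hle, x, hx, hlt⟩ := hC.exists_inner_le_of_notMem_intrinsicInterior
    (hC.integral_mem hCc hXC hX) hmi
  set m := ∫ ω, X ω ∂μ
  have hint : Integrable (fun ω => inner ℝ u m - inner ℝ u (X ω)) μ :=
    (integrable_const _).sub (hX.const_inner u)
  have hzero : ∫ ω, (inner ℝ u m - inner ℝ u (X ω)) ∂μ = 0 := by
    rw [integral_sub (integrable_const _) (hX.const_inner u), integral_inner hX u]
    simp [m]
  have hnonneg : 0 ≤ᵐ[μ] fun ω => inner ℝ u m - inner ℝ u (X ω) := by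
    filter_upwards [hXC] with ω hω
    exact sub_nonneg.2 (hle _ hω)
  rw [integral_eq_zero_iff_of_nonneg_ae hnonneg hint] at hzero
  refine hlt.ne (h u _ ?_ x hx)
  filter_upwards [hzero] with ω hω
  exact (sub_eq_zero.1 hω).symm

end RelativeInterior

/-! ### Conditioning on an independent variable -/

section CondExp

variable {Ω S E F : Type*} [mΩ : MeasurableSpace Ω] [mS : MeasurableSpace S]
  [AddCommGroup E] [MeasurableSpace E] [MeasurableAdd₂ E]
  [NormedAddCommGroup F] {P : Measure Ω} [IsProbabilityMeasure P]
  {W : Ω → S} {Y : Ω → E} {h : S → E} {g : E → F}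

theorem integrable_prod_add_of_indepFun (hW : Measurable W) (hY : Measurable Y)
    (hh : Measurable h) (hWY : IndepFun Y W P) (hg : StronglyMeasurable g)
    (hint : Integrable (fun ω => g (h (W ω) + Y ω)) P) :
    Integrable (fun p : S × E => g (h p.1 + p.2)) ((P.map W).prod (P.map Y)) := by
  have hmap := (indepFun_iff_map_prod_eq_prod_map_map hW.aemeasurable hY.aemeasurable).1 hWY.symm
  have hG : StronglyMeasurable (fun p : S × E => g (h p.1 + p.2)) :=
    hg.comp_measurable ((hh.comp measurable_fst).add measurable_snd)
  rw [← hmap]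
  exact (integrable_map_measure hG.aestronglyMeasurable (hW.prodMk hY).aemeasurable).2 hint

/-- Independence makes the joint law of (W, Y) a product, and Fubini integrates Y out over each
event W ∈ A. -/
theorem condExp_comp_add_of_indepFun [NormedSpace ℝ F] [CompleteSpace F]
    (hW : Measurable W) (hY : Measurable Y)
    (hh : Measurable h) (hWY : IndepFun Y W P) (hg : StronglyMeasurable g)
    (hint : Integrable (fun ω => g (h (W ω) + Y ω)) P) :
    P[fun ω => g (h (W ω) + Y ω) | mS.comap W] =ᵐ[P]
      fun ω => ∫ z, g (h (W ω) + z) ∂P.map Y := by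
  have hmap := (indepFun_iff_map_prod_eq_prod_map_map hW.aemeasurable hY.aemeasurable).1 hWY.symm
  have hG : StronglyMeasurable (fun p : S × E => g (h p.1 + p.2)) :=
    hg.comp_measurable ((hh.comp measurable_fst).add measurable_snd)
  have : IsProbabilityMeasure (P.map Y) := Measure.isProbabilityMeasure_map hY.aemeasurable
  have : IsProbabilityMeasure (P.map W) := Measure.isProbabilityMeasure_map hW.aemeasurable
  have hintp := integrable_prod_add_of_indepFun hW hY hh hWY hg hint
  have hk : StronglyMeasurable (fun w => ∫ z, g (h w + z) ∂P.map Y) :=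
    hG.integral_prod_right
  have hkint : Integrable (fun ω => ∫ z, g (h (W ω) + z) ∂P.map Y) P :=
    (integrable_map_measure hk.aestronglyMeasurable hW.aemeasurable).1 hintp.integral_prod_left
  refine (ae_eq_condExp_of_forall_setIntegral_eq hW.comap_le hint
    (fun s _ _ => hkint.integrableOn) ?_ ?_).symm
  · rintro _ ⟨A, hA, rfl⟩ -
    have h1 : ∫ ω in W ⁻¹' A, g (h (W ω) + Y ω) ∂P =
        ∫ p in A ×ˢ univ, g (h p.1 + p.2) ∂(P.map W).prod (P.map Y) := by
      rw [← hmap, setIntegral_map (hA.prod .univ) hG.aestronglyMeasurable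
        (hW.prodMk hY).aemeasurable]
      congr 2
      ext; simp
    rw [h1, setIntegral_prod _ hintp.integrableOn, Measure.restrict_univ,
      setIntegral_map hA hk.aestronglyMeasurable hW.aemeasurable]
  · exact (hk.comp_measurable (comap_measurable W)).aestronglyMeasurable

end CondExp

theorem measurable_gradient {d : ℕ} (v : EuclideanSpace ℝ (Fin d) → ℝ) : Measurable (∇ v) :=
  (LinearIsometryEquiv.continuous _).measurable.comp (measurable_fderiv ℝ v)

/-- Presents the past as generated by one path-valued variable, the form in which independence of
increments is stated. -/
theorem pastSigmaAlgebra_eq_comap {d : ℕ} {Ω : Type*}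
    (B : I → Ω → EuclideanSpace ℝ (Fin d)) (t : I) :
    pastSigmaAlgebra B t = MeasurableSpace.comap (fun ω (r : Iic t) => B r ω) inferInstance := by
  change _ = MeasurableSpace.comap _ 
    (⨆ r : Iic t, MeasurableSpace.comap
      (fun f : Iic t → EuclideanSpace ℝ (Fin d) => f r) inferInstance)
  rw [pastSigmaAlgebra, MeasurableSpace.comap_iSup, iSup_subtype']
  refine iSup_congr fun r => ?_
  rw [MeasurableSpace.comap_comp]
  rfl

/-! ### Markov property and null sets of the terminal law -/

section Brownian

variable {d : ℕ} {Ω : Type*} [MeasurableSpace Ω] {P : Measure Ω}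
  {B : I → Ω → EuclideanSpace ℝ (Fin d)} {α : Measure (EuclideanSpace ℝ (Fin d))}

namespace IsBrownianMotionOn01

theorem measurable_past (hB : IsBrownianMotionOn01 B α P) (t : I) :
    Measurable fun ω (r : Iic t) => B r ω :=
  measurable_pi_lambda _ fun r => hB.measurable r

theorem map_increment (hB : IsBrownianMotionOn01 B α P) (t : I) :
    P.map (fun ω => B 1 ω - B t ω) = isotropicGaussian d (1 - t) :=
  (hB.hasLaw_increment t 1 unitInterval.le_one').map_eq

theorem indepFun_increment (hB : IsBrownianMotionOn01 B α P) (t : I) :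
    IndepFun (fun ω => B 1 ω - B t ω) (B t) P :=
  (hB.indepFun_past t 1 unitInterval.le_one').comp measurable_id
    (measurable_pi_apply (⟨t, mem_Iic.2 le_rfl⟩ : Iic t))

variable {F : Type*} [NormedAddCommGroup F] {g : EuclideanSpace ℝ (Fin d) → F}

theorem ae_integrable_isotropicGaussian [IsProbabilityMeasure P]
    (hB : IsBrownianMotionOn01 B α P) (hg : StronglyMeasurable g)
    (hint : Integrable (fun ω => g (B 1 ω)) P) (t : I) :
    ∀ᵐ ω ∂P, Integrable (fun z => g (B t ω + z)) (isotropicGaussian d (1 - t)) := by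
  have h := integrable_prod_add_of_indepFun (h := id) (hB.measurable t)
    ((hB.measurable 1).sub (hB.measurable t)) measurable_id (hB.indepFun_increment t) hg
    (by simpa using hint)
  have h' := h.prod_right_ae
  rw [show P.map (B 1 - B t) = isotropicGaussian d (1 - t) from hB.map_increment t] at h'
  exact ae_of_ae_map (hB.measurable t).aemeasurable h'

/-- Conditioning is on the whole past path, with `h` its evaluation at time t. -/
theorem condExp_comp_eq [IsProbabilityMeasure P] [NormedSpace ℝ F] [CompleteSpace F]
    (hB : IsBrownianMotionOn01 B α P) (hg : StronglyMeasurable g)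
    (hint : Integrable (fun ω => g (B 1 ω)) P) (t : I) :
    P[fun ω => g (B 1 ω) | pastSigmaAlgebra B t] =ᵐ[P]
      fun ω => ∫ z, g (B t ω + z) ∂isotropicGaussian d (1 - t) := by
  have h := condExp_comp_add_of_indepFun
    (h := fun w : Iic t → EuclideanSpace ℝ (Fin d) => w ⟨t, mem_Iic.2 le_rfl⟩)
    (hB.measurable_past t) ((hB.measurable 1).sub (hB.measurable t)) (measurable_pi_apply _)
    (hB.indepFun_past t 1 unitInterval.le_one') hg (by simpa using hint)
  rw [show P.map (B 1 - B t) = isotropicGaussian d (1 - t) from hB.map_increment t,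
    ← pastSigmaAlgebra_eq_comap] at h
  simpa using h

/-- The law of B_1 is the convolution of that of B_0 with a standard Gaussian, hence equivalent to
Lebesgue measure. -/
theorem ae_comp_one_iff [IsProbabilityMeasure P] (hB : IsBrownianMotionOn01 B α P)
    {p : EuclideanSpace ℝ (Fin d) → Prop} (hp : MeasurableSet {y | p y}) :
    (∀ᵐ ω ∂P, p (B 1 ω)) ↔ ∀ᵐ y, p y := by
  have hB0 := hB.measurable 0
  have hB1 : Measurable fun ω => B 1 ω - B 0 ω := (hB.measurable 1).sub hB0
  have : IsProbabilityMeasure (P.map (B 0)) := Measure.isProbabilityMeasure_map hB0.aemeasurable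
  have hmap := (indepFun_iff_map_prod_eq_prod_map_map hB0.aemeasurable hB1.aemeasurable).1
    (hB.indepFun_increment 0).symm
  have hinc := hB.map_increment 0
  rw [Set.Icc.coe_zero, sub_zero] at hinc
  rw [hinc] at hmap
  have hadd : MeasurableSet {q : EuclideanSpace ℝ (Fin d) × EuclideanSpace ℝ (Fin d) |
      p (q.1 + q.2)} := (measurable_fst.add measurable_snd) hp
  have h1 : (∀ᵐ ω ∂P, p (B 1 ω)) ↔
      ∀ᵐ q ∂(P.map (B 0)).prod (isotropicGaussian d 1), p (q.1 + q.2) := by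
    rw [← hmap, ae_map_iff (hB0.prodMk hB1).aemeasurable hadd]
    simp
  rw [h1, Measure.ae_prod_iff_ae_ae hadd]
  simp_rw [ae_isotropicGaussian_add_iff one_pos]
  -- The inner condition no longer depends on the starting point, and the law of B_0 is a nonzero
  -- measure.
  exact Filter.eventually_const

end IsBrownianMotionOn01

end Brownian

theorem nhdsWithin_Ioi_inter_neBot_of_dense {S : Set I} (hS : Dense S) {t : I} (ht : t < 1) :
    (nhdsWithin t (Ioi t ∩ S)).NeBot := by
  rw [← mem_closure_iff_nhdsWithin_neBot]
  refine closure_minimal (hS.open_subset_closure_inter isOpen_Ioi) isClosed_closure ?_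
  rw [closure_Ioi' (a := t) ⟨1, ht⟩]
  exact mem_Ici.2 le_rfl

/-! ### The Bass martingale stays in the relative interior -/

section Bass

variable {d : ℕ} {Ω : Type*} [MeasurableSpace Ω] {P : Measure Ω} [IsProbabilityMeasure P]
  {B M : I → Ω → EuclideanSpace ℝ (Fin d)} {α ν : Measure (EuclideanSpace ℝ (Fin d))}
  {g : EuclideanSpace ℝ (Fin d) → EuclideanSpace ℝ (Fin d)}

/-- Both a.e. statements about g(x + z), membership in C and in a hyperplane, pass through Lebesgue
null sets to B_1 and thus to ν; a closed hyperplane of full ν-measure contains the support, hence C.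
-/
theorem integral_isotropicGaussian_mem_riSuppHull (hB : IsBrownianMotionOn01 B α P)
    (hg : Measurable g) (hν : HasLaw (fun ω => g (B 1 ω)) ν P) {r : ℝ} (hr : 0 < r)
    {x : EuclideanSpace ℝ (Fin d)}
    (hint : Integrable (fun z => g (x + z)) (isotropicGaussian d r)) :
    ∫ z, g (x + z) ∂isotropicGaussian d r ∈ riSuppHull ν := by
  have hgB : AEMeasurable (fun ω => g (B 1 ω)) P := hν.aemeasurable
  have hCc : IsClosed (closedConvexHull ℝ ν.support) := isClosed_closedConvexHull
  refine integral_mem_intrinsicInterior hint convex_closedConvexHull hCc ?_ ?_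
  · rw [ae_isotropicGaussian_add_iff hr x (p := fun y => g y ∈ closedConvexHull ℝ ν.support),
      ← hB.ae_comp_one_iff (hg hCc.measurableSet)]
    have h : ∀ᵐ y ∂ν, y ∈ closedConvexHull ℝ ν.support :=
      Filter.mem_of_superset Measure.support_mem_ae subset_closedConvexHull
    exact ae_of_ae_map hgB (hν.map_eq ▸ h)
  · intro u c hu
    have hcl : IsClosed {x : EuclideanSpace ℝ (Fin d) | inner ℝ u x = c} :=
      isClosed_eq (by fun_prop) continuous_const
    rw [ae_isotropicGaussian_add_iff hr x (p := fun y => inner ℝ u (g y) = c),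
      ← hB.ae_comp_one_iff (p := fun y => inner ℝ u (g y) = c) (hg hcl.measurableSet),
      ← ae_map_iff (p := fun y => inner ℝ u y = c) hgB hcl.measurableSet, hν.map_eq] at hu
    refine closedConvexHull_min (Measure.support_subset_of_isClosed hcl hu) ?_ hcl
    exact convex_hyperplane (innerSL ℝ u).isLinear c

theorem ae_forall_mem_riSuppHull (hB : IsBrownianMotionOn01 B α P)
    (hg : Measurable g) (hν : HasLaw (fun ω => g (B 1 ω)) ν P)
    (hint : Integrable (fun ω => g (B 1 ω)) P)
    (hM : ∀ t : I, M t =ᵐ[P] P[fun ω => g (B 1 ω) | pastSigmaAlgebra B t])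
    (hcont : ∀ᵐ ω ∂P, ∀ t : I, ContinuousWithinAt (fun s => M s ω) (Ici t) t) :
    ∀ᵐ ω ∂P, ∀ t : I, t < 1 → M t ω ∈ riSuppHull ν := by
  have hgs := hg.stronglyMeasurable
  have hMt (t : I) := (hM t).trans (hB.condExp_comp_eq hgs hint t)
  have h0 := hB.ae_integrable_isotropicGaussian hgs hint 0
  rw [Set.Icc.coe_zero, sub_zero] at h0
  -- B_0(ω₀) is the one deterministic base point whose integrability at variance 1 controls all
  -- later averages.
  obtain ⟨ω₀, hω₀⟩ := h0.exists
  obtain ⟨S, hSc, hSd⟩ := TopologicalSpace.exists_countable_dense I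
  have hS := (ae_ball_iff hSc).2 fun t _ => hMt t
  filter_upwards [h0, hMt 0, hS, hcont, hB.continuous_paths] with ω hω0 hM0 hωS hωM hωB t ht
  -- At t = 0 the variance is 1, outside the range of the domination argument; there the a.s.
  -- integrability at B_0 is used directly.
  rcases eq_or_lt_of_le (unitInterval.nonneg' (t := t)) with rfl | ht0
  · rw [Set.Icc.coe_zero, sub_zero] at hM0
    rw [hM0]
    exact integral_isotropicGaussian_mem_riSuppHull hB hg hν one_pos hω0
  · have hr : 0 < 1 - (t : ℝ) := sub_pos.2 ht
    have hr1 : 1 - (t : ℝ) < 1 := sub_lt_self _ ht0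
    have hK : ContinuousAt (fun s : I =>
        ∫ z, g (B s ω + z) ∂isotropicGaussian d (1 - s)) t :=
      ContinuousAt.comp (f := fun s : I => ((1 - s : ℝ), B s ω)) (x := t)
        (continuousAt_integral_isotropicGaussian_add hgs.aestronglyMeasurable hω₀ hr hr1 _)
        (by fun_prop)
    -- M_s and K_{1-s}(B_s) agree for s in S; letting s decrease to t within S identifies M_t with
    -- K_{1-t}(B_t).
    have := nhdsWithin_Ioi_inter_neBot_of_dense hSd ht
    have hlim := (hωM t).mono_left (nhdsWithin_mono t
      (inter_subset_left.trans Ioi_subset_Ici_self : Ioi t ∩ S ⊆ Ici t))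
    have hlim' := hK.mono_left (nhdsWithin_le_nhds (s := Ioi t ∩ S))
    have heq := tendsto_nhds_unique hlim (hlim'.congr' (by
      filter_upwards [self_mem_nhdsWithin] with s hs
      exact (hωS s hs.2).symm))
    change M t ω = _ at heq
    rw [heq]
    exact integral_isotropicGaussian_mem_riSuppHull hB hg hν hr
      (integrable_isotropicGaussian_add_of_integrable hgs.aestronglyMeasurable hω₀ hr hr1 _)

end Bass

/-- An exit is possible at time 1 only, and 1 is also the default value when there is no exit. -/
theorem hittingBtwn_compl_eq_one {Ω β : Type*} {X : I → Ω → β} {s : Set β} {ω : Ω}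
    (h : ∀ t : I, t < 1 → X t ω ∈ s) : hittingBtwn X sᶜ 0 1 ω = 1 := by
  rw [hittingBtwn]
  split_ifs with hex
  · refine le_antisymm unitInterval.le_one' (le_csInf ?_ ?_)
    · obtain ⟨j, hj, hjs⟩ := hex
      exact ⟨j, hj, hjs⟩
    · rintro t ⟨-, ht⟩
      by_contra hlt
      exact ht (h t (not_le.1 hlt))
  · rfl

theorem corollary6p8 {d : ℕ} {Ω : Type*} [MeasurableSpace Ω] (P : Measure Ω)
    [IsProbabilityMeasure P] (M : I → Ω → EuclideanSpace ℝ (Fin d)) (hM : IsBassMartingale M P)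
    (ν : Measure (EuclideanSpace ℝ (Fin d))) (hν : HasLaw (M 1) ν P) :
    (∀ᵐ ω ∂P, ∀ t : I, t < 1 → M t ω ∈ riSuppHull ν) ∧
      ∀ᵐ ω ∂P, boundaryTime M ν ω = 1 := by
  obtain ⟨α, B, v, hB, -, hL2, hMt, hcont⟩ := hM
  have hg := measurable_gradient v
  have hint : Integrable (fun ω => ∇ v (B 1 ω)) P := hL2.integrable one_le_two
  have hle : pastSigmaAlgebra B 1 ≤ ‹MeasurableSpace Ω› :=
    iSup₂_le fun s _ => (hB.measurable s).comap_le
  have hB1 : Measurable[pastSigmaAlgebra B 1] (B 1) :=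
    measurable_iff_comap_le.2 (le_iSup₂_of_le 1 le_rfl le_rfl)
  -- B_1 is measurable for the terminal σ-algebra, so ν is the law of ∇v(B_1).
  have hM1 : M 1 =ᵐ[P] fun ω => ∇ v (B 1 ω) := by
    exact (hMt 1).trans
      (condExp_of_stronglyMeasurable hle (hg.comp hB1).stronglyMeasurable hint).eventuallyEq
  have hmain := ae_forall_mem_riSuppHull hB hg (hν.congr hM1.symm) hint hMt hcont
  exact ⟨hmain, hmain.mono fun ω hω => hittingBtwn_compl_eq_one hω⟩
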